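/- Let $m,n,s\ge 0$ be integers, let $\mathbf Y\subset\mathbb R^n$ be compact, and let $h,\psi_1,\dots,\psi_s:\mathbb R^m\to\mathbb R$ be continuous convex functions. Let $p:\mathbb R^m\times\mathbb R^n\to\mathbb R$ be a lower semicontinuous function such that $p(\cdot,y)$ is continuous and convex for every $y\in\mathbf Y$ and $p(x,\cdot)$ is continuous on $\mathbb R^n$ for every $x\in\mathbb R^m$. Assume that the feasible region $$\mathbf K=\{x\in\mathbb R^m:\ \psi_j(x)\le 0\ (j=1,\dots,s),\ p(x,y)\le 0\ \text{for all } y\in\mathbf Y\}$$ is nonempty. For $f:\mathbb R^m\to\mathbb R$ let $f^*(\xi)=\sup_{x\in\mathbb R^m}\{\langle\xi,x\rangle-f(x)\}\in\mathbb R\cup\{+\infty\}$ be its conjugate, and let $\operatorname{epi} f^*=\{(\xi,\alpha)\in\mathbb R^m\times\mathbb R:\ f^*(\xi)\le\alpha\}$. Let $\mathcal M(\mathbf Y)$ be the set of finite nonnegative Borel measures supported on $\mathbf Y$, and put $$\mathcal C_1=\bigcup_{\mu\in\mathcal M(\mathbf Y)}\operatorname{epi}\Big(\int_{\mathbf Y}p(\cdot,y)\,d\mu(y)\Big)^*,\qquad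 \mathcal C_2=\bigcup_{\eta\in\mathbb R_+^s}\operatorname{epi}\Big(\sum_{j=1}^s\eta_j\psi_j\Big)^*.$$ Then exactly one of the following two statements holds: (i) there exists $x\in\mathbb R^m$ with $h(x)<0$, $\psi_j(x)\le 0$ for $j=1,\dots,s$, and $p(x,y)\le 0$ for all $y\in\mathbf Y$; (ii) $(0,0)\in\operatorname{epi}h^*+\operatorname{cl}(\mathcal C_1+\mathcal C_2)$, where $\operatorname{cl}$ denotes the closure in $\mathbb R^m\times\mathbb R$. -/

import Mathlib

open MeasureTheory
open scoped Pointwise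

noncomputable section

/-- The Euclidean space `ℝᵏ`. -/
abbrev Euc (k : ℕ) : Type := EuclideanSpace ℝ (Fin k)

/-- The conjugate `f*(ξ) = sup_x (⟨ξ, x⟩ - f x)` of an extended-real-valued function on `ℝᵐ`. -/
def conjugate {m : ℕ} (f : Euc m → EReal) (ξ : Euc m) : EReal :=
  ⨆ x : Euc m, ((inner ℝ ξ x : ℝ) : EReal) - f x

/-- The epigraph of an extended-real-valued function on `ℝᵐ`, a subset of `ℝᵐ × ℝ`. -/
def epigraph {m : ℕ} (f : Euc m → EReal) : Set (Euc m × ℝ) :=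
  {q | f q.1 ≤ (q.2 : EReal)}

/-- `epi f*` for a finite-valued function `f` on `ℝᵐ`. -/
def epiConj {m : ℕ} (f : Euc m → ℝ) : Set (Euc m × ℝ) :=
  epigraph (conjugate fun x => (f x : EReal))

/-- The finite nonnegative Borel measures on `ℝⁿ` that are supported on `Y`. -/
def measuresOn {n : ℕ} (Y : Set (Euc n)) : Set (Measure (Euc n)) :=
  {μ | IsFiniteMeasure μ ∧ μ Yᶜ = 0}

/-- The union of `epi (∫_Y p(·, y) dμ(y))*` over all finite nonnegative measures `μ` on `Y`. -/
def coneC₁ {m n : ℕ} (p : Euc m → Euc n → ℝ) (Y : Set (Euc n)) : Set (Euc m × ℝ) :=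
  ⋃ μ ∈ measuresOn Y, epiConj fun x => ∫ y in Y, p x y ∂μ

/-- The union of `epi (∑ⱼ ηⱼ ψⱼ)*` over all `η ∈ ℝˢ` with nonnegative entries. -/
def coneC₂ {m s : ℕ} (ψ : Fin s → Euc m → ℝ) : Set (Euc m × ℝ) :=
  ⋃ η ∈ {η : Fin s → ℝ | ∀ j, 0 ≤ η j}, epiConj fun x => ∑ j, η j * ψ j x

/-- The feasible region: all `x` with `ψⱼ(x) ≤ 0` for every `j` and `p(x, y) ≤ 0` for every
`y ∈ Y`. -/
def feasibleSet {m n s : ℕ} (ψ : Fin s → Euc m → ℝ) (p : Euc m → Euc n → ℝ)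
    (Y : Set (Euc n)) : Set (Euc m) :=
  {x | (∀ j, ψ j x ≤ 0) ∧ ∀ y ∈ Y, p x y ≤ 0}

end

/-! Read a pair `(ξ, α)` as the inequality `⟨ξ, x⟩ ≤ α`. The closed cone consists exactly of the
inequalities valid on the feasible set (`inner_le_of_mem_closure`, `mem_closure_of_forall_inner_le`,
a Farkas lemma). If (i) fails, `h ≥ 0` there, and `exists_mem_epiConj_of_nonneg` gives `a ∈ epiConj
h` with `-a` valid, so `0 = a + (-a)`. Conversely, a decomposition of zero, evaluated at a feasible
point, forces `h ≥ 0`. -/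

theorem mem_epiConj {m : ℕ} {f : Euc m → ℝ} {q : Euc m × ℝ} :
    q ∈ epiConj f ↔ ∀ x, inner ℝ q.1 x - f x ≤ q.2 := by
  simp only [epiConj, epigraph, conjugate, Set.mem_ofPred_eq, iSup_le_iff]
  refine forall_congr' fun x => ?_
  rw [← EReal.coe_sub, EReal.coe_le_coe_iff]

/-- Continuous linear functionals on `ℝᵐ × ℝ` are given by a vector and a scalar. -/
theorem exists_inner_add_mul_eq {m : ℕ} (φ : (Euc m × ℝ) →L[ℝ] ℝ) :
    ∃ (v : Euc m) (t : ℝ), ∀ q, φ q = inner ℝ v q.1 + t * q.2 := by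
  refine ⟨(InnerProductSpace.toDual ℝ (Euc m)).symm (φ.comp (.inl ℝ (Euc m) ℝ)), φ (0, 1),
    fun q => ?_⟩
  rw [InnerProductSpace.toDual_symm_apply]
  have hq : q = (q.1, 0) + q.2 • ((0, 1) : Euc m × ℝ) := by ext <;> simp
  conv_lhs => rw [hq, map_add, map_smul]
  simp [mul_comm]

/-- A convex function that is nonnegative on a nonempty convex set `K` is minorized by an affine
function that is nonnegative on `K`. -/
theorem exists_mem_epiConj_of_nonneg {m : ℕ} {f : Euc m → ℝ} {K : Set (Euc m)}
    (f_cont : Continuous f) (f_conv : ConvexOn ℝ Set.univ f) (K_conv : Convex ℝ K)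
    (K_nonempty : K.Nonempty) (f_nonneg : ∀ x ∈ K, 0 ≤ f x) :
    ∃ q ∈ epiConj f, ∀ x ∈ K, q.2 ≤ inner ℝ q.1 x := by
  have epi_conv : Convex ℝ {z : Euc m × ℝ | f z.1 < z.2} := by
    simpa using f_conv.convex_strict_epigraph
  have epi_open : IsOpen {z : Euc m × ℝ | f z.1 < z.2} :=
    isOpen_lt (f_cont.comp continuous_fst) continuous_snd
  have disj : Disjoint {z : Euc m × ℝ | f z.1 < z.2} (K ×ˢ Set.Iic (0 : ℝ)) := by
    rw [Set.disjoint_left]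
    rintro ⟨x, r⟩ hlt ⟨hx, hr⟩
    have := f_nonneg x hx
    simp only [Set.mem_ofPred_eq, Set.mem_Iic] at hlt hr
    linarith
  obtain ⟨φ, u, hφ₁, hφ₂⟩ :=
    geometric_hahn_banach_open epi_conv epi_open (K_conv.prod (convex_Iic 0)) disj
  obtain ⟨v, t, hφ⟩ := exists_inner_add_mul_eq φ
  have upper : ∀ x r, f x < r → inner ℝ v x + t * r < u := fun x r hr => by
    simpa [hφ] using hφ₁ (x, r) hr
  have lower : ∀ x ∈ K, u ≤ inner ℝ v x := fun x hx => by
    simpa [hφ] using hφ₂ (x, 0) ⟨hx, Set.self_mem_Iic⟩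
  -- The hyperplane is not vertical: over a point of `K` it strictly separates two points of the
  -- same fibre.
  have t_neg : t < 0 := by
    obtain ⟨x, hx⟩ := K_nonempty
    have h₁ := upper x (f x + 1) (by linarith)
    have h₂ := lower x hx
    have h₃ := f_nonneg x hx
    by_contra! ht
    nlinarith
  refine ⟨((-t)⁻¹ • v, (-t)⁻¹ * u), mem_epiConj.2 fun x => ?_, fun x hx => ?_⟩
  -- Only the strict epigraph was separated, so the bound at `f x` is a limit.
  · refine le_of_forall_pos_le_add fun ε hε => ?_
    have h₁ := upper x (f x + ε) (by linarith)
    have h₂ := mul_le_mul_of_nonneg_left h₁.le (inv_nonneg.2 (neg_nonneg.2 t_neg.le))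
    have h₃ : (-t)⁻¹ * t = -1 := by rw [inv_neg, neg_mul, inv_mul_cancel₀ t_neg.ne]
    rw [real_inner_smul_left]
    linear_combination h₂ - (f x + ε) * h₃
  · rw [real_inner_smul_left]
    exact mul_le_mul_of_nonneg_left (lower x hx) (inv_nonneg.2 (neg_nonneg.2 t_neg.le))

/-- A point bounded by all affine minorants of `f` lies in the sublevel set of `f`. -/
theorem nonpos_of_forall_mem_epiConj {m : ℕ} {f : Euc m → ℝ} (f_cont : Continuous f)
    (f_conv : ConvexOn ℝ Set.univ f) {x : Euc m}
    (hx : ∀ q ∈ epiConj f, inner ℝ q.1 x ≤ q.2) : f x ≤ 0 := by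
  obtain ⟨q, hq, hqx⟩ := exists_mem_epiConj_of_nonneg (f := fun z => f z + -f x) (K := {x})
    (f_cont.add continuous_const) (f_conv.add (convexOn_const _ convex_univ))
    (convex_singleton x) (Set.singleton_nonempty x) (by simp)
  have h₁ := hx (q.1, q.2 - f x) (mem_epiConj.2 fun z => by
    have := mem_epiConj.1 hq z
    simp only at this ⊢
    linarith)
  have h₂ := hqx x rfl
  simp only at h₁
  linarith

theorem add_mem_epiConj {m : ℕ} {f g : Euc m → ℝ} {q r : Euc m × ℝ} (hq : q ∈ epiConj f)
    (hr : r ∈ epiConj g) : q + r ∈ epiConj fun x => f x + g x := by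
  refine mem_epiConj.2 fun x => ?_
  have h₁ := mem_epiConj.1 hq x
  have h₂ := mem_epiConj.1 hr x
  simp only [Prod.fst_add, Prod.snd_add, inner_add_left]
  linarith

theorem smul_mem_epiConj {m : ℕ} {f : Euc m → ℝ} {q : Euc m × ℝ} {c : ℝ} (hc : 0 ≤ c)
    (hq : q ∈ epiConj f) : c • q ∈ epiConj fun x => c * f x := by
  refine mem_epiConj.2 fun x => ?_
  have h₁ := mul_le_mul_of_nonneg_left (mem_epiConj.1 hq x) hc
  simp only [Prod.smul_fst, Prod.smul_snd, real_inner_smul_left, smul_eq_mul]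
  linarith

theorem mem_coneC₁ {m n : ℕ} {p : Euc m → Euc n → ℝ} {Y : Set (Euc n)} {q : Euc m × ℝ} :
    q ∈ coneC₁ p Y ↔
      ∃ μ : Measure (Euc n), (IsFiniteMeasure μ ∧ μ Yᶜ = 0) ∧
        q ∈ epiConj fun x => ∫ y in Y, p x y ∂μ := by
  simp [coneC₁, measuresOn]

theorem mem_coneC₂ {m s : ℕ} {ψ : Fin s → Euc m → ℝ} {q : Euc m × ℝ} :
    q ∈ coneC₂ ψ ↔ ∃ η : Fin s → ℝ, (∀ j, 0 ≤ η j) ∧ q ∈ epiConj fun x => ∑ j, η j * ψ j x := by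
  simp [coneC₂]

/-- `coneC₁` as a convex cone. -/
def convexConeC₁ {m n : ℕ} (p : Euc m → Euc n → ℝ) (Y : Set (Euc n))
    (p_cont : ∀ x, Continuous (p x)) (Y_compact : IsCompact Y) : ConvexCone ℝ (Euc m × ℝ) where
  carrier := coneC₁ p Y
  smul_mem' c hc q hq := by
    obtain ⟨μ, ⟨_, hμY⟩, hq⟩ := mem_coneC₁.1 hq
    refine mem_coneC₁.2 ⟨c.toNNReal • μ, ⟨inferInstance, by simp [hμY]⟩, ?_⟩
    convert smul_mem_epiConj hc.le hq using 3 with x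
    rw [Measure.restrict_smul, integral_smul_nnreal_measure, NNReal.smul_def,
      Real.coe_toNNReal c hc.le, smul_eq_mul]
  add_mem' q hq r hr := by
    obtain ⟨μ, ⟨_, hμY⟩, hq⟩ := mem_coneC₁.1 hq
    obtain ⟨ν, ⟨_, hνY⟩, hr⟩ := mem_coneC₁.1 hr
    refine mem_coneC₁.2 ⟨μ + ν, ⟨inferInstance, by simp [hμY, hνY]⟩, ?_⟩
    convert add_mem_epiConj hq hr using 3 with x
    rw [Measure.restrict_add, integral_add_measure]
    · exact (p_cont x).continuousOn.integrableOn_compact Y_compact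
    · exact (p_cont x).continuousOn.integrableOn_compact Y_compact

/-- `coneC₂` as a convex cone. -/
def convexConeC₂ {m s : ℕ} (ψ : Fin s → Euc m → ℝ) : ConvexCone ℝ (Euc m × ℝ) where
  carrier := coneC₂ ψ
  smul_mem' c hc q hq := by
    obtain ⟨η, hη, hq⟩ := mem_coneC₂.1 hq
    refine mem_coneC₂.2 ⟨fun j => c * η j, fun j => mul_nonneg hc.le (hη j), ?_⟩
    convert smul_mem_epiConj hc.le hq using 3 with x
    simp only [Finset.mul_sum, mul_assoc]
  add_mem' q hq r hr := by
    obtain ⟨η, hη, hq⟩ := mem_coneC₂.1 hq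
    obtain ⟨θ, hθ, hr⟩ := mem_coneC₂.1 hr
    refine mem_coneC₂.2 ⟨fun j => η j + θ j, fun j => add_nonneg (hη j) (hθ j), ?_⟩
    convert add_mem_epiConj hq hr using 3 with x
    simp only [add_mul, Finset.sum_add_distrib]

/-- The zero measure supplies a vertical ray, which later fixes the sign of the separating
functional's last coefficient. -/
theorem mem_coneC₁_of_nonneg {m n : ℕ} (p : Euc m → Euc n → ℝ) (Y : Set (Euc n)) {α : ℝ}
    (hα : 0 ≤ α) : ((0, α) : Euc m × ℝ) ∈ coneC₁ p Y :=
  mem_coneC₁.2 ⟨0, ⟨inferInstance, by simp⟩, mem_epiConj.2 fun x => by simpa using hα⟩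

theorem zero_mem_coneC₂ {m s : ℕ} (ψ : Fin s → Euc m → ℝ) : (0 : Euc m × ℝ) ∈ coneC₂ ψ :=
  mem_coneC₂.2 ⟨0, fun _ => le_rfl, mem_epiConj.2 fun x => by simp⟩

/-- A Dirac mass isolates one constraint, so a point satisfying all inequalities of the cone is
feasible. -/
theorem epiConj_subset_coneC₁ {m n : ℕ} {p : Euc m → Euc n → ℝ} {Y : Set (Euc n)}
    (Y_meas : MeasurableSet Y) {y : Euc n} (hy : y ∈ Y) :
    epiConj (fun x => p x y) ⊆ coneC₁ p Y := by
  classical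
  refine fun q hq => mem_coneC₁.2 ⟨Measure.dirac y, ⟨inferInstance, ?_⟩, ?_⟩
  · rw [Measure.dirac_apply' _ Y_meas.compl]
    simp [hy]
  · convert hq using 3 with x
    rw [setIntegral_dirac, if_pos hy]

theorem epiConj_subset_coneC₂ {m s : ℕ} (ψ : Fin s → Euc m → ℝ) (j : Fin s) :
    epiConj (ψ j) ⊆ coneC₂ ψ := by
  refine fun q hq => mem_coneC₂.2 ⟨Pi.single j 1, fun i => ?_, ?_⟩
  · by_cases hij : i = j
    · subst hij; simp
    · simp [hij]
  · convert hq using 3 with x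
    simp [Pi.single_apply]

/-- Elements of the closed cone are affine inequalities valid on the feasible set. -/
theorem inner_le_of_mem_closure {m n s : ℕ} {ψ : Fin s → Euc m → ℝ} {p : Euc m → Euc n → ℝ}
    {Y : Set (Euc n)} (Y_meas : MeasurableSet Y) {q : Euc m × ℝ}
    (hq : q ∈ closure (coneC₁ p Y + coneC₂ ψ)) {x : Euc m} (hx : x ∈ feasibleSet ψ p Y) :
    inner ℝ q.1 x ≤ q.2 := by
  have hclosed : IsClosed {q : Euc m × ℝ | inner ℝ q.1 x ≤ q.2} :=
    isClosed_le (continuous_fst.inner continuous_const) continuous_snd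
  refine closure_minimal ?_ hclosed hq
  rintro _ ⟨a, ha, b, hb, rfl⟩
  obtain ⟨μ, -, ha⟩ := mem_coneC₁.1 ha
  obtain ⟨η, hη, hb⟩ := mem_coneC₂.1 hb
  have h₁ := mem_epiConj.1 ha x
  have h₂ := mem_epiConj.1 hb x
  have h₃ : ∫ y in Y, p x y ∂μ ≤ 0 := setIntegral_nonpos Y_meas fun y hy => hx.2 y hy
  have h₄ : ∑ j, η j * ψ j x ≤ 0 :=
    Finset.sum_nonpos fun j _ => mul_nonpos_of_nonneg_of_nonpos (hη j) (hx.1 j)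
  simp only [Set.mem_ofPred_eq, Prod.fst_add, Prod.snd_add, inner_add_left]
  linarith

/-- Every affine inequality valid on the nonempty feasible set lies in the closed cone. -/
theorem mem_closure_of_forall_inner_le {m n s : ℕ} {ψ : Fin s → Euc m → ℝ}
    {p : Euc m → Euc n → ℝ} {Y : Set (Euc n)}
    (ψ_cont : ∀ j, Continuous (ψ j)) (ψ_conv : ∀ j, ConvexOn ℝ Set.univ (ψ j))
    (p_cont_left : ∀ y ∈ Y, Continuous fun x => p x y)
    (p_conv : ∀ y ∈ Y, ConvexOn ℝ Set.univ fun x => p x y)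
    (p_cont_right : ∀ x, Continuous (p x)) (Y_compact : IsCompact Y)
    (K_nonempty : (feasibleSet ψ p Y).Nonempty) {q : Euc m × ℝ}
    (hq : ∀ x ∈ feasibleSet ψ p Y, inner ℝ q.1 x ≤ q.2) :
    q ∈ closure (coneC₁ p Y + coneC₂ ψ) := by
  have Y_meas := Y_compact.measurableSet
  by_contra hnot
  let D := convexConeC₁ p Y p_cont_right Y_compact + convexConeC₂ ψ
  have hD : (D : Set (Euc m × ℝ)) = coneC₁ p Y + coneC₂ ψ := rfl
  have hC₁ : coneC₁ p Y ⊆ D := fun a ha => by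
    rw [hD, ← add_zero a]
    exact Set.add_mem_add ha (zero_mem_coneC₂ ψ)
  have hC₂ : coneC₂ ψ ⊆ D := fun a ha => by
    rw [hD, ← zero_add a]
    exact Set.add_mem_add (mem_coneC₁_of_nonneg p Y le_rfl) ha
  obtain ⟨φ, u, hφD, hφq⟩ := geometric_hahn_banach_closed_point
    (hD ▸ D.convex.closure) isClosed_closure hnot
  have φ_nonpos : ∀ a ∈ D, φ a ≤ 0 := by
    intro a ha
    by_contra! hpos
    have hu : 0 < u := hpos.trans (hφD a (subset_closure ha))
    -- This multiple of `a` stays in the cone, yet `φ` takes the value `u` on it.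
    have := hφD ((u / φ a) • a) (subset_closure (D.smul_mem (div_pos hu hpos) ha))
    rw [map_smul, smul_eq_mul, div_mul_cancel₀ _ hpos.ne'] at this
    exact lt_irrefl _ this
  have u_pos : 0 < u := by
    have := hφD 0 (subset_closure (hC₁ (mem_coneC₁_of_nonneg p Y le_rfl)))
    simpa using this
  obtain ⟨v, t, hφ⟩ := exists_inner_add_mul_eq φ
  have t_nonpos : t ≤ 0 := by
    simpa [hφ] using φ_nonpos (0, 1) (hC₁ (mem_coneC₁_of_nonneg p Y zero_le_one))
  obtain ⟨z, hz⟩ := K_nonempty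
  -- Perturbing by the feasible point `z` makes the separating hyperplane non-vertical.
  obtain ⟨ε, hε, hεq⟩ : ∃ ε : ℝ, 0 < ε ∧ 0 < φ q + ε * (inner ℝ q.1 z - q.2) := by
    have hd : 0 ≤ q.2 - inner ℝ q.1 z := sub_nonneg.2 (hq z hz)
    -- With `d = q.2 - ⟨q.1, z⟩ ≥ 0`, this `ε` leaves `φ q - ε * d = ε > 0`.
    refine ⟨φ q / (q.2 - inner ℝ q.1 z + 1), by have := u_pos.trans hφq; positivity, ?_⟩
    have hpos := u_pos.trans hφq
    have : φ q + φ q / (q.2 - inner ℝ q.1 z + 1) * (inner ℝ q.1 z - q.2) =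
        φ q / (q.2 - inner ℝ q.1 z + 1) := by
      field_simp
      ring
    rw [this]
    positivity
  have hτ : 0 < ε - t := by linarith
  -- Normalizes the perturbed functional to `a ↦ ⟨a.1, x⟩ - a.2`; `x` will be a feasible point
  -- violating `q`.
  set x : Euc m := (ε - t)⁻¹ • (v + ε • z) with hx
  have inner_x : ∀ a : Euc m × ℝ,
      (ε - t) * (inner ℝ a.1 x - a.2) = φ a + ε * (inner ℝ a.1 z - a.2) := by
    intro a
    rw [hx, hφ, real_inner_smul_right, inner_add_right, real_inner_smul_right,
      real_inner_comm v a.1, mul_sub, mul_inv_cancel_left₀ hτ.ne']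
    ring
  have hxD : ∀ a ∈ D, inner ℝ a.1 x ≤ a.2 := by
    intro a ha
    have h₁ := φ_nonpos a ha
    have h₂ := inner_le_of_mem_closure Y_meas (subset_closure ha) hz
    have h₃ := inner_x a
    by_contra! hlt
    have h₄ := mul_pos hτ (sub_pos.2 hlt)
    nlinarith
  have hxK : x ∈ feasibleSet ψ p Y :=
    ⟨fun j => nonpos_of_forall_mem_epiConj (ψ_cont j) (ψ_conv j) fun a ha =>
      hxD a (hC₂ (epiConj_subset_coneC₂ ψ j ha)),
    fun y hy => nonpos_of_forall_mem_epiConj (p_cont_left y hy) (p_conv y hy) fun a ha =>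
      hxD a (hC₁ (epiConj_subset_coneC₁ Y_meas hy ha))⟩
  have h₁ := hq x hxK
  have h₂ := inner_x q
  nlinarith

theorem convex_feasibleSet {m n s : ℕ} {ψ : Fin s → Euc m → ℝ} {p : Euc m → Euc n → ℝ}
    {Y : Set (Euc n)} (ψ_conv : ∀ j, ConvexOn ℝ Set.univ (ψ j))
    (p_conv : ∀ y ∈ Y, ConvexOn ℝ Set.univ fun x => p x y) :
    Convex ℝ (feasibleSet ψ p Y) := by
  intro a ha b hb c d hc hd hcd
  refine ⟨fun j => ?_, fun y hy => ?_⟩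
  · exact ((ψ_conv j).convex_le 0 ⟨trivial, ha.1 j⟩ ⟨trivial, hb.1 j⟩ hc hd hcd).2
  · exact ((p_conv y hy).convex_le 0 ⟨trivial, ha.2 y hy⟩ ⟨trivial, hb.2 y hy⟩ hc hd hcd).2

theorem mainTheorem8 {m n s : ℕ} (h : Euc m → ℝ) (ψ : Fin s → Euc m → ℝ)
    (p : Euc m → Euc n → ℝ) (Y : Set (Euc n))
    (h_cont : Continuous h) (h_conv : ConvexOn ℝ Set.univ h)
    (ψ_cont : ∀ j, Continuous (ψ j)) (ψ_conv : ∀ j, ConvexOn ℝ Set.univ (ψ j))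
    (p_cont_left : ∀ y ∈ Y, Continuous fun x => p x y)
    (p_conv : ∀ y ∈ Y, ConvexOn ℝ Set.univ fun x => p x y)
    (p_lsc : LowerSemicontinuous fun z : Euc m × Euc n => p z.1 z.2)
    (p_cont_right : ∀ x, Continuous (p x))
    (Y_compact : IsCompact Y)
    (K_nonempty : (feasibleSet ψ p Y).Nonempty) :
    Xor (∃ x : Euc m, h x < 0 ∧ (∀ j, ψ j x ≤ 0) ∧ ∀ y ∈ Y, p x y ≤ 0)
      (((0, 0) : Euc m × ℝ) ∈ epiConj h + closure (coneC₁ p Y + coneC₂ ψ)) := by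
  rw [xor_iff_iff_not]
  constructor
  · rintro ⟨x, hx, hxψ, hxp⟩ ⟨a, ha, b, hb, hab⟩
    have h₁ := mem_epiConj.1 ha x
    have h₂ := inner_le_of_mem_closure Y_compact.measurableSet hb ⟨hxψ, hxp⟩
    have h₃ : a.1 + b.1 = 0 := congrArg Prod.fst hab
    have h₄ : a.2 + b.2 = 0 := congrArg Prod.snd hab
    have h₅ : inner ℝ a.1 x + inner ℝ b.1 x = 0 := by
      rw [← inner_add_left, h₃, inner_zero_left]
    linarith
  · contrapose!
    intro hnot
    have h_nonneg : ∀ x ∈ feasibleSet ψ p Y, 0 ≤ h x := by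
      intro x hx
      by_contra! hlt
      obtain ⟨y, hy, hpos⟩ := hnot x hlt hx.1
      exact absurd (hx.2 y hy) (not_le.2 hpos)
    obtain ⟨a, ha, haK⟩ := exists_mem_epiConj_of_nonneg h_cont h_conv
      (convex_feasibleSet ψ_conv p_conv) K_nonempty h_nonneg
    refine ⟨a, ha, -a, ?_, add_neg_cancel a⟩
    refine mem_closure_of_forall_inner_le ψ_cont ψ_conv p_cont_left p_conv p_cont_right
      Y_compact K_nonempty fun x hx => ?_
    simpa using haK x hx
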